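/- Let $\varphi:\mathbb R\to\mathbb R$ be an Orlicz N-function, i.e. $\varphi$ is continuous, even and convex, strictly increasing on $(0,\infty)$, $\varphi(0)=0$, $\varphi(x)/x\to0$ as $x\to0$ and $\varphi(x)/x\to\infty$ as $x\to\infty$. Let $\varphi^{(-1)}:[0,\infty)\to[0,\infty)$ be the inverse of the restriction of $\varphi$ to $[0,\infty)$, and assume $\varphi^{(-1)}(1)=1$. For a real random variable $Y$ put $$\|Y\|_{\tau_{\tilde\varphi}}:=\sup_{p\ge1}\frac{\|Y\|_p}{\varphi^{(-1)}(p)}\in[0,\infty].$$ Let $X=(X_1,\dots,X_n)$ be a vector of independent (not necessarily identically distributed) random variables with values in a measurable space $\Omega$, and let $f:\Omega^n\to\mathbb R$ be measurable with $\mathbb E|f(X)|<\infty$. For $1\le k\le n$ and $x\in\Omega^n$ define the $k$-th centered conditional version of $f$ as the random variable $$f_k(X)(x)=f(x_1,\dots,x_{k-1},X_k,x_{k+1},\dots,x_n)-\mathbb E\big[f(x_1,\dots,x_{k-1},X_k',x_{k+1},\dots,x_n)\big],$$ where $X_k'$ is a copy of $X_k$. For each fixed $x$ let $\|f_k(X)\|_{\tau_{\tilde\varphi}}(x):=\|f_k(X)(x)\|_{\tau_{\tilde\varphi}}$,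 and let $\|g\|_\infty$ denote the essential supremum of a function $g:\Omega^n\to[0,\infty]$ with respect to the law of $X$. Then for every $t>0$ $$\mathbb P\big(f(X)-\mathbb E f(X)>t\big)\le\exp\left(\frac{-t^2}{4e^2\,\big\|\sum_{k}\|f_k(X)\|_{\tau_{\tilde\varphi}}^2\big\|_\infty+2e\,\max_k\big\|\,\|f_k(X)\|_{\tau_{\tilde\varphi}}\big\|_\infty\,t}\right),$$ where the right-hand side is read as $0$ if the denominator is $0$ and as $1$ if the denominator is $\infty$. -/

import Mathlib

open MeasureTheory ProbabilityTheory Filter Topology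
open scoped ENNReal

noncomputable section

/-- Orlicz N-functions: continuous, even, convex functions on `ℝ`, increasing for `x > 0`, with
`φ 0 = 0`, `φ x / x → 0` as `x → 0` and `φ x / x → ∞` as `x → ∞`. -/
structure IsOrliczNFunction (φ : ℝ → ℝ) : Prop where
  continuous : Continuous φ
  even : ∀ x, φ (-x) = φ x
  convexOn : ConvexOn ℝ Set.univ φ
  strictMonoOn : StrictMonoOn φ (Set.Ioi 0)
  map_zero : φ 0 = 0
  tendsto_zero : Tendsto (fun x => φ x / x) (𝓝[≠] 0) (𝓝 0)
  tendsto_atTop : Tendsto (fun x => φ x / x) atTop atTop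

/-- The inverse function `φ^(-1) : [0, ∞) → [0, ∞)` of an Orlicz N-function `φ` (that is, of the
bijection of `[0, ∞)` to which `φ` restricts). -/
def orliczInv (φ : ℝ → ℝ) : ℝ → ℝ := Function.invFunOn φ (Set.Ici 0)

/-- The norm `‖Y‖ = sup_{p ≥ 1} ‖Y‖_p / φ^(-1)(p)` of a real random variable `Y`, with value `∞`
if the supremum is infinite. -/
def orliczMomentNorm {S : Type*} [MeasurableSpace S] (φ : ℝ → ℝ) (Y : S → ℝ) (P : Measure S) :
    ℝ≥0∞ :=
  ⨆ (p : ℝ) (_ : 1 ≤ p), eLpNorm Y (ENNReal.ofReal p) P / ENNReal.ofReal (orliczInv φ p)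

/-- The `k`-th centered conditional version `f_k(X)(x)` of `f`: the random variable
`f(x_1, …, x_{k-1}, X_k, x_{k+1}, …, x_n) - E f(x_1, …, x_{k-1}, X_k', x_{k+1}, …, x_n)`. The
expectation over the copy `X_k'` is the expectation over `X_k` itself, as their laws agree. -/
def centeredCondVersion {S Ω : Type*} [MeasurableSpace S] {n : ℕ} (P : Measure S)
    (X : Fin n → S → Ω) (f : (Fin n → Ω) → ℝ) (k : Fin n) (x : Fin n → Ω) : S → ℝ :=
  fun s => f (Function.update x k (X k s)) - ∫ s', f (Function.update x k (X k s')) ∂P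

/-- `‖ ∑_k ‖f_k(X)‖² ‖_∞`: the inner norms are those of `f_k(X)(x)` for fixed `x`, and the outer
norm is the essential supremum when `x` is distributed as `X`. -/
def condVarianceProxy {S Ω : Type*} [MeasurableSpace S] {n : ℕ} (φ : ℝ → ℝ) (P : Measure S)
    (X : Fin n → S → Ω) (f : (Fin n → Ω) → ℝ) : ℝ≥0∞ :=
  essSup (fun s => ∑ k, orliczMomentNorm φ (centeredCondVersion P X f k (fun i => X i s)) P ^ 2) P

/-- `max_k ‖ ‖f_k(X)‖ ‖_∞`, read in the same way. -/
def condScaleProxy {S Ω : Type*} [MeasurableSpace S] {n : ℕ} (φ : ℝ → ℝ) (P : Measure S)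
    (X : Fin n → S → Ω) (f : (Fin n → Ω) → ℝ) : ℝ≥0∞ :=
  ⨆ k, essSup (fun s => orliczMomentNorm φ (centeredCondVersion P X f k (fun i => X i s)) P) P

end

/-! The proof is the entropy method. Normalization and convexity give `φ⁻¹(p) ≤ p` for `p ≥ 1`, so
only the weaker norm `K`, with `‖Y‖_p ≤ K p` at positive integers, is needed. As `p ^ p ≤ e ^ p p!`,
it yields `E|Y|^p ≤ (e K)^p p!`, and power series in `βY` are dominated by geometric-type series in
`|β| e K`. In particular, for `h(u) = u e^u - e^u + 1`, `E h(βY) ≤ (β e K)² / (1 - |β| e M)²`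
whenever `K ≤ M` and `|β| e M < 1`.

Let `m_k` be the average of `f` over coordinate `k` and `K_k` the norm of `f - m_k` in that
coordinate. Subadditivity of entropy, in the form `Ent(e^{βf}) ≤ ∑ E[e^{βm_k} h(β(f - m_k))]`,
followed by Jensen for `e^{βm_k}`, bounds the entropy by a constant times `E[e^{βf} ∑ K_k²]`, hence
by a multiple of the mgf (`integral_exp_mul_log_le`). Herbst's argument (`cgf_le_of_entropy_le`)
turns this into a sub-gamma bound on the cgf with `v = e² V` and `a = e M`, and Chernoff's bound
finishes. Finiteness of the mgf is not assumed: it is proved beforehand by integrating out one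
coordinate at a time (`CondExpMomentLE`). -/

/-! ### Elementary series. -/

theorem natCast_pow_self_le_exp_pow_mul_factorial (p : ℕ) :
    (p : ℝ≥0∞) ^ p ≤ ENNReal.ofReal (Real.exp 1) ^ p * (p.factorial : ℝ≥0∞) := by
  have h := Real.pow_div_factorial_le_exp (p : ℝ) (Nat.cast_nonneg p) p
  rw [div_le_iff₀ (by positivity), show (p : ℝ) = p * 1 by ring, Real.exp_nat_mul] at h
  have h2 := ENNReal.ofReal_le_ofReal h
  rw [ENNReal.ofReal_mul (by positivity), ENNReal.ofReal_pow (by positivity),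
    ENNReal.ofReal_pow (by positivity)] at h2
  simpa using h2

/-- The coefficient of `u ^ p / p!` in `u e^u - e^u` is `p - 1`; the summand `1` cancels the value
`-1` at `p = 0`, in agreement with truncated subtraction. -/
theorem hasSum_pred_mul_pow_div_factorial (u : ℝ) :
    HasSum (fun p : ℕ => ((p - 1 : ℕ) : ℝ) * ((p.factorial : ℝ)⁻¹ * u ^ p))
      (u * Real.exp u - Real.exp u + 1) := by
  have h1 : HasSum (fun p : ℕ => (p.factorial : ℝ)⁻¹ * u ^ p) (Real.exp u) := by
    have := NormedSpace.expSeries_div_hasSum_exp (𝔸 := ℝ) u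
    rw [← Real.exp_eq_exp_ℝ] at this
    simpa [div_eq_inv_mul] using this
  have h2 : HasSum (fun p : ℕ => (p : ℝ) * ((p.factorial : ℝ)⁻¹ * u ^ p)) (u * Real.exp u) := by
    rw [← hasSum_nat_add_iff' 1]
    simp only [Finset.range_one, Finset.sum_singleton, Nat.cast_zero, zero_mul, sub_zero]
    refine (h1.mul_left u).congr_fun ?_
    intro p
    rw [Nat.factorial_succ]
    have : (p.factorial : ℝ) ≠ 0 := by positivity
    push_cast
    field_simp
    ring
  have h3 := (h2.sub h1).add (hasSum_ite_eq (0 : ℕ) (1 : ℝ))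
  refine h3.congr_fun ?_
  intro p
  rcases p with _ | p
  · simp
  · simp
    ring_nf

theorem ENNReal.tsum_succ_mul_geometric_ofReal {r : ℝ} (h0 : 0 ≤ r) (h1 : r < 1) :
    ∑' q : ℕ, ((q + 1 : ℕ) : ℝ≥0∞) * ENNReal.ofReal r ^ q = ENNReal.ofReal (1 / (1 - r) ^ 2) := by
  have hr : ‖r‖ < 1 := by rwa [Real.norm_of_nonneg h0]
  have h := hasSum_choose_mul_geometric_of_norm_lt_one 1 hr
  simp only [Nat.choose_one_right] at h
  rw [← h.tsum_eq, ENNReal.ofReal_tsum_of_nonneg (fun n => by positivity) h.summable]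
  congr 1 with q
  rw [ENNReal.ofReal_mul (by positivity), ENNReal.ofReal_pow h0, ENNReal.ofReal_natCast]

/-- The smallest `K` such that `‖Y‖_p ≤ K p` for all positive integers `p`. -/
noncomputable def linearMomentNorm {Ω : Type*} [MeasurableSpace Ω] (Y : Ω → ℝ) (ν : Measure Ω) :
    ℝ≥0∞ :=
  ⨆ p : ℕ, eLpNorm Y ((p + 1 : ℕ) : ℝ≥0∞) ν / ((p + 1 : ℕ) : ℝ≥0∞)

/-! ### Exponential estimates for one variable from linear moment growth. -/

section OneVariable

variable {Ω : Type*} [MeasurableSpace Ω] {ν : Measure Ω} [IsProbabilityMeasure ν] {Y : Ω → ℝ}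

theorem lintegral_enorm_pow_le_linearMomentNorm (p : ℕ) :
    ∫⁻ y, ‖Y y‖ₑ ^ p ∂ν ≤ (linearMomentNorm Y ν * p) ^ p := by
  rcases p with _ | p
  · simp
  have h : eLpNorm Y ((p + 1 : ℕ) : ℝ≥0∞) ν ≤ linearMomentNorm Y ν * ((p + 1 : ℕ) : ℝ≥0∞) := by
    rw [← ENNReal.div_le_iff (by simp) (ENNReal.natCast_ne_top _)]
    exact le_iSup (fun p : ℕ => eLpNorm Y ((p + 1 : ℕ) : ℝ≥0∞) ν / ((p + 1 : ℕ) : ℝ≥0∞)) p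
  refine le_trans (le_of_eq ?_) (pow_le_pow_left' h (p + 1))
  rw [eLpNorm_eq_lintegral_rpow_enorm_toReal (by simp) (ENNReal.natCast_ne_top _),
    ENNReal.toReal_natCast, ← ENNReal.rpow_natCast, ← ENNReal.rpow_mul,
    one_div, inv_mul_cancel₀ (by positivity), ENNReal.rpow_one]
  simp_rw [ENNReal.rpow_natCast]

/-- The factor `p!` in `E|Y|^p ≤ (K p)^p ≤ (e K)^p p!` cancels the `1 / p!` of the series. Weights
`c p = 1` serve for `exp`, and `c p = p - 1` for the entropy term. -/
theorem lintegral_tsum_moments_le (hY : AEMeasurable Y ν) (c : ℕ → ℝ≥0∞) (b : ℝ≥0∞) :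
    ∫⁻ y, ∑' p : ℕ, c p * ((p.factorial : ℝ≥0∞)⁻¹ * (b * ‖Y y‖ₑ) ^ p) ∂ν ≤
      ∑' p : ℕ, c p * (b * ENNReal.ofReal (Real.exp 1) * linearMomentNorm Y ν) ^ p := by
  rw [lintegral_tsum (fun p => by fun_prop)]
  refine ENNReal.tsum_le_tsum fun p => ?_
  rw [lintegral_const_mul'' _ (by fun_prop), lintegral_const_mul'' _ (by fun_prop)]
  gcongr
  simp_rw [mul_pow]
  rw [lintegral_const_mul'' _ (by fun_prop)]
  calc (p.factorial : ℝ≥0∞)⁻¹ * (b ^ p * ∫⁻ y, ‖Y y‖ₑ ^ p ∂ν)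
      ≤ (p.factorial : ℝ≥0∞)⁻¹ * (b ^ p * (linearMomentNorm Y ν ^ p *
          (ENNReal.ofReal (Real.exp 1) ^ p * (p.factorial : ℝ≥0∞)))) := by
        gcongr
        refine (lintegral_enorm_pow_le_linearMomentNorm p).trans ?_
        rw [mul_pow]
        gcongr
        exact natCast_pow_self_le_exp_pow_mul_factorial p
    _ = ((p.factorial : ℝ≥0∞)⁻¹ * (p.factorial : ℝ≥0∞)) *
          (b ^ p * ENNReal.ofReal (Real.exp 1) ^ p * linearMomentNorm Y ν ^ p) := by ring
    _ = _ := by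
        rw [ENNReal.inv_mul_cancel (by positivity) (ENNReal.natCast_ne_top _), one_mul]

theorem ofReal_tsum_le_tsum_enorm {c : ℕ → ℕ} {u v : ℝ}
    (h : HasSum (fun p : ℕ => (c p : ℝ) * ((p.factorial : ℝ)⁻¹ * u ^ p)) v) :
    ENNReal.ofReal v ≤ ∑' p : ℕ, (c p : ℝ≥0∞) * ((p.factorial : ℝ≥0∞)⁻¹ * ‖u‖ₑ ^ p) := by
  calc ENNReal.ofReal v ≤ ‖v‖ₑ := Real.ofReal_le_enorm v
    _ ≤ ∑' p : ℕ, ‖(c p : ℝ) * ((p.factorial : ℝ)⁻¹ * u ^ p)‖ₑ := by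
        rw [← h.tsum_eq]; exact enorm_tsum_le_tsum_enorm
    _ = _ := by
        congr 1 with p
        rw [enorm_mul, enorm_mul, enorm_pow, enorm_inv (by positivity)]
        simp [Real.enorm_natCast]

theorem lintegral_exp_mul_le_of_linearMomentNorm (hY : AEMeasurable Y ν) (β : ℝ) :
    ∫⁻ y, ENNReal.ofReal (Real.exp (β * Y y)) ∂ν ≤
      (1 - ‖β‖ₑ * ENNReal.ofReal (Real.exp 1) * linearMomentNorm Y ν)⁻¹ := by
  rw [← ENNReal.tsum_geometric]
  have h := lintegral_tsum_moments_le hY (fun _ => ((1 : ℕ) : ℝ≥0∞)) ‖β‖ₑ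
  simp only [Nat.cast_one, one_mul] at h
  refine le_trans (lintegral_mono fun y => ?_) h
  have h1 : HasSum (fun p : ℕ => ((1 : ℕ) : ℝ) * ((p.factorial : ℝ)⁻¹ * (β * Y y) ^ p))
      (Real.exp (β * Y y)) := by
    have := NormedSpace.expSeries_div_hasSum_exp (𝔸 := ℝ) (β * Y y)
    rw [← Real.exp_eq_exp_ℝ] at this
    simpa [div_eq_inv_mul] using this
  simpa [enorm_mul] using ofReal_tsum_le_tsum_enorm (c := fun _ => 1) h1

theorem lintegral_mul_exp_sub_exp_add_one_le (hY : AEMeasurable Y ν) (β : ℝ) {M : ℝ} (hM : 0 ≤ M)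
    (hK : linearMomentNorm Y ν ≤ ENNReal.ofReal M) (hβ : |β| * Real.exp 1 * M < 1) :
    ∫⁻ y, ENNReal.ofReal (β * Y y * Real.exp (β * Y y) - Real.exp (β * Y y) + 1) ∂ν ≤
      ENNReal.ofReal ((β * Real.exp 1) ^ 2 / (1 - |β| * Real.exp 1 * M) ^ 2) *
        linearMomentNorm Y ν ^ 2 := by
  have h := lintegral_tsum_moments_le hY (fun p => ((p - 1 : ℕ) : ℝ≥0∞)) ‖β‖ₑ
  refine le_trans (le_trans (lintegral_mono fun y => ?_) h) ?_
  · simpa [enorm_mul] using ofReal_tsum_le_tsum_enorm (c := fun p => p - 1)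
      (hasSum_pred_mul_pow_div_factorial (β * Y y))
  set K := linearMomentNorm Y ν
  set a := ‖β‖ₑ * ENNReal.ofReal (Real.exp 1) * K with ha
  have haA : a ≤ ENNReal.ofReal (|β| * Real.exp 1 * M) := by
    rw [ENNReal.ofReal_mul (by positivity), ENNReal.ofReal_mul (by positivity), ha,
      Real.enorm_eq_ofReal_abs]
    gcongr
  -- The terms `p = 0, 1` vanish, which makes the bound quadratic in the norm.
  have hshift : ∑' p : ℕ, ((p - 1 : ℕ) : ℝ≥0∞) * a ^ p =
      a ^ 2 * ∑' q : ℕ, ((q + 1 : ℕ) : ℝ≥0∞) * a ^ q := by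
    rw [tsum_eq_zero_add' ENNReal.summable, tsum_eq_zero_add' ENNReal.summable,
      ← ENNReal.tsum_mul_left]
    simp only [zero_tsub, Nat.cast_zero, zero_mul, zero_add, tsub_self, add_tsub_cancel_right]
    congr 1 with q
    ring
  rw [hshift]
  -- Only the series is bounded uniformly through `M`; the prefactor keeps the actual norm, whose
  -- squares are later summed over coordinates.
  calc a ^ 2 * ∑' q : ℕ, ((q + 1 : ℕ) : ℝ≥0∞) * a ^ q
      ≤ a ^ 2 * ∑' q : ℕ, ((q + 1 : ℕ) : ℝ≥0∞) * ENNReal.ofReal (|β| * Real.exp 1 * M) ^ q := by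
        gcongr
    _ = _ := by
        rw [ENNReal.tsum_succ_mul_geometric_ofReal (by positivity) hβ,
          div_eq_mul_one_div ((β * Real.exp 1) ^ 2),
          ENNReal.ofReal_mul (by positivity), ha, mul_pow, Real.enorm_eq_ofReal_abs,
          ← ENNReal.ofReal_mul (by positivity), ← ENNReal.ofReal_pow (by positivity), mul_pow |β|,
          sq_abs, ← mul_pow]
        ring

end OneVariable

/-! ### Averaging over one coordinate, and finiteness of exponential moments. -/

section Product

variable {Ω ι : Type*} [MeasurableSpace Ω] [DecidableEq ι]

theorem measurable_update_prod (k : ι) :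
    Measurable fun z : (ι → Ω) × Ω => Function.update z.1 k z.2 :=
  measurable_update'

variable {μ : ι → Measure Ω}

/-- The integral of `f` over the coordinate `k`. -/
noncomputable def coordIntegral (μ : ι → Measure Ω) (k : ι) (f : (ι → Ω) → ℝ) (x : ι → Ω) : ℝ :=
  ∫ y, f (Function.update x k y) ∂μ k

theorem coordIntegral_update (k : ι) (f : (ι → Ω) → ℝ) (x : ι → Ω) (y : Ω) :
    coordIntegral μ k f (Function.update x k y) = coordIntegral μ k f x := by
  simp [coordIntegral]

theorem coordIntegral_update_of_forall (j k : ι) {f : (ι → Ω) → ℝ}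
    (h : ∀ x y, f (Function.update x j y) = f x) (x : ι → Ω) (y : Ω) :
    coordIntegral μ k f (Function.update x j y) = coordIntegral μ k f x := by
  rcases eq_or_ne j k with rfl | hjk
  · exact coordIntegral_update j f x y
  · unfold coordIntegral
    congr 1 with z
    rw [Function.update_comm hjk, h]

variable [Fintype ι] [∀ i, IsProbabilityMeasure (μ i)]

/-- Resampling one coordinate independently preserves a product measure. -/
theorem lintegral_pi_update (k : ι) {F : (ι → Ω) → ℝ≥0∞} (hF : Measurable F) :
    ∫⁻ x, ∫⁻ y, F (Function.update x k y) ∂μ k ∂Measure.pi μ = ∫⁻ x, F x ∂Measure.pi μ := by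
  rcases isEmpty_or_nonempty (ι → Ω) with h | ⟨⟨x₀⟩⟩
  · simp [lintegral_of_isEmpty]
  have hG : Measurable fun x => ∫⁻ y, F (Function.update x k y) ∂μ k :=
    Measurable.lintegral_prod_right' (hF.comp (measurable_update_prod k))
  rw [lintegral_eq_lmarginal_univ x₀, lintegral_eq_lmarginal_univ x₀,
    lmarginal_erase' _ hG (Finset.mem_univ k), lmarginal_erase' _ hF (Finset.mem_univ k)]
  simp

theorem measurePreserving_update (k : ι) :
    MeasurePreserving (fun z : (ι → Ω) × Ω => Function.update z.1 k z.2)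
      ((Measure.pi μ).prod (μ k)) (Measure.pi μ) := by
  refine ⟨measurable_update_prod k, Measure.ext_of_lintegral _ fun F hF => ?_⟩
  rw [lintegral_map hF (measurable_update_prod k),
    lintegral_prod (fun z : (ι → Ω) × Ω => F (Function.update z.1 k z.2))
      (hF.comp (measurable_update_prod k)).aemeasurable, lintegral_pi_update k hF]

theorem measurable_coordIntegral (k : ι) {f : (ι → Ω) → ℝ} (hf : Measurable f) :
    Measurable (coordIntegral μ k f) :=
  ((hf.comp (measurable_update_prod k)).stronglyMeasurable.integral_prod_right').measurable

theorem integrable_prod_update (k : ι) {f : (ι → Ω) → ℝ} (hf : Integrable f (Measure.pi μ)) :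
    Integrable (fun z : (ι → Ω) × Ω => f (Function.update z.1 k z.2))
      ((Measure.pi μ).prod (μ k)) :=
  (measurePreserving_update k).integrable_comp_of_integrable hf

theorem integrable_coordIntegral (k : ι) {f : (ι → Ω) → ℝ} (hf : Integrable f (Measure.pi μ)) :
    Integrable (coordIntegral μ k f) (Measure.pi μ) :=
  (integrable_prod_update k hf).integral_prod_left

theorem ae_integrable_update (k : ι) {f : (ι → Ω) → ℝ} (hf : Integrable f (Measure.pi μ)) :
    ∀ᵐ x ∂Measure.pi μ, Integrable (fun y => f (Function.update x k y)) (μ k) :=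
  (integrable_prod_update k hf).prod_right_ae

theorem ae_ae_update (k : ι) {p : (ι → Ω) → Prop} (hp : ∀ᵐ x ∂Measure.pi μ, p x) :
    ∀ᵐ x ∂Measure.pi μ, ∀ᵐ y ∂μ k, p (Function.update x k y) :=
  Measure.ae_ae_of_ae_prod ((measurePreserving_update k).quasiMeasurePreserving.ae hp)

theorem ofReal_exp_integral_le {ν : Measure Ω} [IsProbabilityMeasure ν] {h : Ω → ℝ}
    (hm : Measurable h) (hi : Integrable h ν) :
    ENNReal.ofReal (Real.exp (∫ y, h y ∂ν)) ≤ ∫⁻ y, ENNReal.ofReal (Real.exp (h y)) ∂ν := by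
  by_cases hfin : ∫⁻ y, ENNReal.ofReal (Real.exp (h y)) ∂ν = ∞
  · simp [hfin]
  have hexp : Integrable (fun y => Real.exp (h y)) ν := by
    refine ⟨by fun_prop, ?_⟩
    rw [hasFiniteIntegral_iff_ofReal (ae_of_all _ fun _ => (Real.exp_pos _).le)]
    exact lt_top_iff_ne_top.2 hfin
  rw [← ofReal_integral_eq_lintegral_ofReal hexp (ae_of_all _ fun _ => (Real.exp_pos _).le)]
  exact ENNReal.ofReal_le_ofReal (convexOn_exp.map_integral_le Real.continuous_exp.continuousOn
    isClosed_univ (by simp) hi hexp)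

/-- All conditional exponential moments of `f` around its conditional means are at most `C`. -/
def CondExpMomentLE (μ : ι → Measure Ω) (β : ℝ) (C : ℝ≥0∞) (f : (ι → Ω) → ℝ) : Prop :=
  ∀ k, ∀ᵐ x ∂Measure.pi μ,
    ∫⁻ y, ENNReal.ofReal (Real.exp (β * (f (Function.update x k y) - coordIntegral μ k f x))) ∂μ k
      ≤ C

/-- By Fubini, centering in `k` commutes with averaging over `j ≠ k`; Jensen and Tonelli then
preserve the bound. For `j = k` the centered function is zero, whence `1 ≤ C`. -/
theorem CondExpMomentLE.comp_coordIntegral {β : ℝ} {C : ℝ≥0∞} (hC : 1 ≤ C) {f : (ι → Ω) → ℝ}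
    (hf : Measurable f) (hi : Integrable f (Measure.pi μ)) (h : CondExpMomentLE μ β C f) (j : ι) :
    CondExpMomentLE μ β C (coordIntegral μ j f) := by
  intro k
  rcases eq_or_ne j k with rfl | hjk
  · refine ae_of_all _ fun x => ?_
    simp only [coordIntegral_update]
    have : coordIntegral μ j (coordIntegral μ j f) x = coordIntegral μ j f x := by
      conv_lhs => unfold coordIntegral
      simp [coordIntegral]
    simpa [this] using hC
  have hg : Integrable (fun x => f x - coordIntegral μ k f x) (Measure.pi μ) :=
    hi.sub (integrable_coordIntegral k hi)
  have hgm : Measurable (fun x => f x - coordIntegral μ k f x) :=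
    hf.sub (measurable_coordIntegral k hf)
  have hprod : ∀ᵐ x ∂Measure.pi μ,
      Integrable (fun z : Ω × Ω => f (Function.update (Function.update x j z.1) k z.2))
        ((μ j).prod (μ k)) := by
    have h1 : MeasurePreserving (fun z : (ι → Ω) × (Ω × Ω) =>
        Function.update (Function.update z.1 j z.2.1) k z.2.2)
        ((Measure.pi μ).prod ((μ j).prod (μ k))) (Measure.pi μ) :=
      ((measurePreserving_update k).comp
        ((measurePreserving_update (μ := μ) j).prod (MeasurePreserving.id (μ k)))).comp
        (measurePreserving_prodAssoc (Measure.pi μ) (μ j) (μ k)).symm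
    exact (h1.integrable_comp_of_integrable hi).prod_right_ae
  filter_upwards [ae_ae_update j (h k), hprod,
    ae_ae_update k (ae_integrable_update j hi), ae_ae_update k (ae_integrable_update j hg)]
    with x hx hpx hix hgx
  have hswap : coordIntegral μ k (coordIntegral μ j f) x =
      coordIntegral μ j (coordIntegral μ k f) x := by
    unfold coordIntegral
    simp_rw [Function.update_comm hjk.symm]
    exact (integral_integral_swap hpx).symm
  have hsub : ∀ᵐ y ∂μ k, coordIntegral μ j f (Function.update x k y) -
      coordIntegral μ k (coordIntegral μ j f) x =
      ∫ z, (f (Function.update (Function.update x j z) k y) -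
        coordIntegral μ k f (Function.update x j z)) ∂μ j := by
    filter_upwards [hix] with y hy
    rw [integral_sub, hswap]
    · unfold coordIntegral
      simp_rw [Function.update_comm hjk.symm]
    · simp_rw [Function.update_comm hjk]
      exact hy
    · exact hpx.integral_prod_left
  calc ∫⁻ y, ENNReal.ofReal (Real.exp (β * (coordIntegral μ j f (Function.update x k y) -
        coordIntegral μ k (coordIntegral μ j f) x))) ∂μ k
      ≤ ∫⁻ y, ∫⁻ z, ENNReal.ofReal (Real.exp (β *
          (f (Function.update (Function.update x j z) k y) -
          coordIntegral μ k f (Function.update x j z)))) ∂μ j ∂μ k := by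
        refine lintegral_mono_ae ?_
        filter_upwards [hsub, hix, hgx] with y hy hiy hgy
        rw [hy, ← integral_const_mul]
        refine ofReal_exp_integral_le ?_ ?_
        · exact ((hf.comp ((measurable_update_left).comp (measurable_update x))).sub
            ((measurable_coordIntegral k hf).comp (measurable_update x))).const_mul β
        · refine Integrable.const_mul ?_ β
          simpa only [Function.update_comm hjk.symm, coordIntegral_update] using hgy
    _ = ∫⁻ z, ∫⁻ y, ENNReal.ofReal (Real.exp (β *
          (f (Function.update (Function.update x j z) k y) -
          coordIntegral μ k f (Function.update x j z)))) ∂μ k ∂μ j := by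
        refine lintegral_lintegral_swap (Measurable.aemeasurable ?_)
        have h1 : Measurable fun z : Ω × Ω => Function.update (Function.update x j z.2) k z.1 :=
          (measurable_update_prod k).comp
            (((measurable_update x).comp measurable_snd).prodMk measurable_fst)
        exact ((((hf.comp h1).sub ((measurable_coordIntegral k hf).comp
          ((measurable_update x).comp measurable_snd))).const_mul β).exp).ennreal_ofReal
    _ ≤ ∫⁻ z, C ∂μ j := lintegral_mono_ae hx
    _ = C := by simp

theorem CondExpMomentLE.lintegral_exp_le {β : ℝ} {C : ℝ≥0∞} {f : (ι → Ω) → ℝ}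
    (hf : Measurable f) (h : CondExpMomentLE μ β C f) (k : ι) :
    ∫⁻ x, ENNReal.ofReal (Real.exp (β * f x)) ∂Measure.pi μ ≤
      C * ∫⁻ x, ENNReal.ofReal (Real.exp (β * coordIntegral μ k f x)) ∂Measure.pi μ := by
  rw [← lintegral_pi_update k (by fun_prop),
    ← lintegral_const_mul _ (((measurable_coordIntegral k hf).const_mul β).exp.ennreal_ofReal)]
  refine lintegral_mono_ae ?_
  filter_upwards [h k] with x hx
  calc ∫⁻ y, ENNReal.ofReal (Real.exp (β * f (Function.update x k y))) ∂μ k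
      = ∫⁻ y, ENNReal.ofReal (Real.exp (β * (f (Function.update x k y) -
          coordIntegral μ k f x))) *
          ENNReal.ofReal (Real.exp (β * coordIntegral μ k f x)) ∂μ k := by
        congr 1 with y
        rw [← ENNReal.ofReal_mul (Real.exp_pos _).le, ← Real.exp_add]
        ring_nf
    _ ≤ _ := by
        rw [lintegral_mul_const' _ _ ENNReal.ofReal_ne_top]
        gcongr

/-- Averaging out a coordinate costs a factor `C` and removes it from the list of those `f` may
depend on; with none left, `f` is constant. -/
theorem CondExpMomentLE.lintegral_exp_lt_top_of_list {β : ℝ} {C : ℝ≥0∞} (hC : 1 ≤ C)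
    (hC' : C < ∞) (l : List ι) {f : (ι → Ω) → ℝ}
    (hf : Measurable f) (hi : Integrable f (Measure.pi μ)) (h : CondExpMomentLE μ β C f)
    (hl : ∀ k ∉ l, ∀ x y, f (Function.update x k y) = f x) :
    ∫⁻ x, ENNReal.ofReal (Real.exp (β * f x)) ∂Measure.pi μ < ∞ := by
  induction l generalizing f with
  | nil =>
    have hconst : ∀ x x' : ι → Ω, f x = f x' := by
      intro x x'
      have key : ∀ s : Finset ι, f (s.piecewise x x') = f x' := by
        intro s
        induction s using Finset.induction with
        | empty => simp
        | insert k s _ ih => rw [Finset.piecewise_insert, hl k (by simp), ih]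
      simpa using key Finset.univ
    rcases isEmpty_or_nonempty (ι → Ω) with h0 | ⟨⟨x₀⟩⟩
    · simp [lintegral_of_isEmpty]
    · simp_rw [fun x => hconst x x₀]
      simp
  | cons k l ih =>
    refine (h.lintegral_exp_le hf k).trans_lt (ENNReal.mul_lt_top hC' ?_)
    refine ih (measurable_coordIntegral k hf) (integrable_coordIntegral k hi)
      (h.comp_coordIntegral hC hf hi k) fun j hj x y => ?_
    rcases eq_or_ne j k with rfl | hjk
    · exact coordIntegral_update j f x y
    · exact coordIntegral_update_of_forall j k (hl j (by simp [hjk, hj])) x y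

theorem CondExpMomentLE.integrable_exp {β : ℝ} {C : ℝ≥0∞} (hC : 1 ≤ C) (hC' : C < ∞)
    {f : (ι → Ω) → ℝ} (hf : Measurable f) (hi : Integrable f (Measure.pi μ))
    (h : CondExpMomentLE μ β C f) :
    Integrable (fun x => Real.exp (β * f x)) (Measure.pi μ) := by
  refine ⟨by fun_prop, ?_⟩
  rw [hasFiniteIntegral_iff_ofReal (ae_of_all _ fun _ => (Real.exp_pos _).le)]
  exact h.lintegral_exp_lt_top_of_list hC hC' Finset.univ.toList hf hi (by simp)

end Product

/-! ### Subadditivity of entropy on the product space. -/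

section Tensorization

variable {Ω ι : Type*} [MeasurableSpace Ω] [Fintype ι] [DecidableEq ι]
variable {μ : ι → Measure Ω} [∀ i, IsProbabilityMeasure (μ i)]

theorem lintegral_lmarginal (s : Finset ι) {g : (ι → Ω) → ℝ≥0∞} (hg : Measurable g) :
    ∫⁻ x, (∫⋯∫⁻_s, g ∂μ) x ∂Measure.pi μ = ∫⁻ x, g x ∂Measure.pi μ := by
  induction s using Finset.induction with
  | empty => simp
  | insert k s hk ih =>
    rw [← ih, ← lintegral_pi_update k (F := ∫⋯∫⁻_s, g ∂μ) (hg.lmarginal μ)]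
    simp_rw [lmarginal_insert g hg hk]

theorem lmarginal_ne_zero (s : Finset ι) {g : (ι → Ω) → ℝ≥0∞} (hg : Measurable g)
    (h0 : ∀ x, g x ≠ 0) (x : ι → Ω) : (∫⋯∫⁻_s, g ∂μ) x ≠ 0 := by
  intro h
  have h := (lintegral_eq_zero_iff (hg.comp measurable_updateFinset)).1 h
  obtain ⟨y, hy⟩ := h.exists
  exact h0 _ hy

/-- Telescoping product of ratios of successive marginals, the chain rule behind subadditivity of
entropy. The partial integrals of the ratios are `≤ 1` rather than `= 1` because `∞ / ∞ = 0`. -/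
theorem exists_ae_eq_lmarginal_mul_prod {g : (ι → Ω) → ℝ≥0∞} (hg : Measurable g)
    (h0 : ∀ x, g x ≠ 0) (hfin : ∫⁻ x, g x ∂Measure.pi μ ≠ ∞) (s : Finset ι) :
    ∃ r : ι → (ι → Ω) → ℝ≥0∞, (∀ k, Measurable (r k)) ∧
      (∀ k x, ∫⁻ y, r k (Function.update x k y) ∂μ k ≤ 1) ∧
      ∀ᵐ x ∂Measure.pi μ, g x = (∫⋯∫⁻_s, g ∂μ) x * ∏ k ∈ s, r k x := by
  induction s using Finset.induction with
  | empty => exact ⟨fun _ _ => 1, fun _ => measurable_const, by simp, by simp⟩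
  | insert k s hk ih =>
    obtain ⟨r, hrm, hr1, hr⟩ := ih
    refine ⟨Function.update r k
      fun x => (∫⋯∫⁻_s, g ∂μ) x / (∫⋯∫⁻_insert k s, g ∂μ) x, fun j => ?_, fun j x => ?_, ?_⟩
    · rcases eq_or_ne j k with rfl | hj
      · rw [Function.update_self]
        exact (hg.lmarginal μ).div (hg.lmarginal μ)
      · simpa [hj] using hrm j
    · rcases eq_or_ne j k with rfl | hj
      · simp only [Function.update_self]
        simp_rw [lmarginal_update_of_mem μ (Finset.mem_insert_self j s), div_eq_mul_inv]
        have hm : Measurable fun y => (∫⋯∫⁻_s, g ∂μ) (Function.update x j y) :=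
          (hg.lmarginal μ).comp (measurable_update x)
        rw [lintegral_mul_const _ hm, ← lmarginal_insert g hg hk, ← div_eq_mul_inv]
        exact ENNReal.div_self_le_one
      · simpa [hj] using hr1 j x
    · have hlt : ∀ᵐ x ∂Measure.pi μ, (∫⋯∫⁻_insert k s, g ∂μ) x < ∞ :=
        ae_lt_top (hg.lmarginal μ) (by rwa [lintegral_lmarginal _ hg])
      filter_upwards [hr, hlt] with x hx hxt
      have hprod : ∏ j ∈ s, Function.update r k
          (fun x => (∫⋯∫⁻_s, g ∂μ) x / (∫⋯∫⁻_insert k s, g ∂μ) x) j x = ∏ j ∈ s, r j x := by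
        refine Finset.prod_congr rfl fun j hj => ?_
        rw [Function.update_of_ne (ne_of_mem_of_not_mem hj hk)]
      rw [Finset.prod_insert hk, hprod, Function.update_self, ← mul_assoc,
        ENNReal.mul_div_cancel (lmarginal_ne_zero _ hg h0 x) hxt.ne]
      exact hx

/-- Pointwise Gibbs variational inequality: `log x ≤ x - 1` at `x = r / h`. -/
theorem mul_log_le_mul_log_sub_add {h r : ℝ} (hh : 0 < h) (hr : 0 < r) :
    h * Real.log r ≤ h * Real.log h - h + r := by
  have h1 := Real.log_le_sub_one_of_pos (div_pos hr hh)
  rw [Real.log_div hr.ne' hh.ne'] at h1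
  have h2 := mul_le_mul_of_nonneg_left h1 hh.le
  have h3 : h * (r / h - 1) = r - h := by field_simp
  linarith

/-- The moment norm of `f`, centered at its mean, as a function of the coordinate `k`. -/
noncomputable def coordMomentNorm (μ : ι → Measure Ω) (f : (ι → Ω) → ℝ) (k : ι) (x : ι → Ω) :
    ℝ≥0∞ :=
  linearMomentNorm (fun y => f (Function.update x k y) - coordIntegral μ k f x) (μ k)

theorem coordMomentNorm_update (f : (ι → Ω) → ℝ) (k : ι) (x : ι → Ω) (y : Ω) :
    coordMomentNorm μ f k (Function.update x k y) = coordMomentNorm μ f k x := by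
  simp [coordMomentNorm, coordIntegral_update]

/-- Restricting to integer exponents makes the supremum countable. -/
theorem measurable_coordMomentNorm {f : (ι → Ω) → ℝ} (hf : Measurable f) (k : ι) :
    Measurable (coordMomentNorm μ f k) := by
  unfold coordMomentNorm linearMomentNorm
  refine Measurable.iSup fun p => Measurable.div_const ?_ _
  simp_rw [eLpNorm_eq_lintegral_rpow_enorm_toReal (p := ((p + 1 : ℕ) : ℝ≥0∞)) (by simp)
    (ENNReal.natCast_ne_top _)]
  refine Measurable.pow_const (Measurable.lintegral_prod_right' (f := fun z : (ι → Ω) × Ω =>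
    ‖f (Function.update z.1 k z.2) - coordIntegral μ k f z.1‖ₑ ^
      ((p + 1 : ℕ) : ℝ≥0∞).toReal) ?_) _
  exact (((hf.comp (measurable_update_prod k)).sub
    ((measurable_coordIntegral k hf).comp measurable_fst)).enorm).pow_const _

variable {f : (ι → Ω) → ℝ} {M V β : ℝ}

theorem condExpMomentLE_of_coordMomentNorm_le (hf : Measurable f)
    (hK : ∀ k, ∀ᵐ x ∂Measure.pi μ, coordMomentNorm μ f k x ≤ ENNReal.ofReal M) :
    CondExpMomentLE μ β (1 - ENNReal.ofReal (|β| * Real.exp 1 * M))⁻¹ f := by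
  intro k
  filter_upwards [hK k] with x hx
  refine (lintegral_exp_mul_le_of_linearMomentNorm (ν := μ k)
    (Y := fun y => f (Function.update x k y) - coordIntegral μ k f x)
    ((hf.comp (measurable_update x)).sub_const _).aemeasurable β).trans ?_
  rw [ENNReal.ofReal_mul (by positivity), ENNReal.ofReal_mul (by positivity),
    Real.enorm_eq_ofReal_abs]
  gcongr
  exact hx

theorem integrable_exp_of_coordMomentNorm_le (hf : Measurable f)
    (hi : Integrable f (Measure.pi μ))
    (hK : ∀ k, ∀ᵐ x ∂Measure.pi μ, coordMomentNorm μ f k x ≤ ENNReal.ofReal M)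
    (hβ : |β| * Real.exp 1 * M < 1) :
    Integrable (fun x => Real.exp (β * f x)) (Measure.pi μ) := by
  refine (condExpMomentLE_of_coordMomentNorm_le hf hK).integrable_exp ?_ ?_ hf hi
  · simp
  · rw [ENNReal.inv_lt_top, tsub_pos_iff_lt]
    simpa using hβ

/-- Neither `m_k` nor `K_k` depends on coordinate `k`, so integrating that coordinate first
separates the factors: the one-variable bound handles the entropy term, and Jensen replaces
`e^{βm_k}` by the average of `e^{βf}`. -/
theorem lintegral_exp_mul_entropyTerm_le (hf : Measurable f) (hi : Integrable f (Measure.pi μ))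
    (hM : 0 ≤ M) (k : ι)
    (hK : ∀ᵐ x ∂Measure.pi μ, coordMomentNorm μ f k x ≤ ENNReal.ofReal M)
    (hβ : |β| * Real.exp 1 * M < 1) :
    ∫⁻ x, ENNReal.ofReal (Real.exp (β * coordIntegral μ k f x)) *
        ENNReal.ofReal (β * (f x - coordIntegral μ k f x) *
          Real.exp (β * (f x - coordIntegral μ k f x)) -
          Real.exp (β * (f x - coordIntegral μ k f x)) + 1) ∂Measure.pi μ ≤
      ENNReal.ofReal ((β * Real.exp 1) ^ 2 / (1 - |β| * Real.exp 1 * M) ^ 2) *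
        ∫⁻ x, ENNReal.ofReal (Real.exp (β * f x)) * coordMomentNorm μ f k x ^ 2 ∂Measure.pi μ := by
  have hmi := measurable_coordIntegral (μ := μ) k hf
  have hmK := measurable_coordMomentNorm (μ := μ) hf k
  conv_lhs => rw [← lintegral_pi_update k (by fun_prop)]
  conv_rhs => rw [← lintegral_pi_update k (by fun_prop)]
  rw [← lintegral_const_mul' _ _ ENNReal.ofReal_ne_top]
  refine lintegral_mono_ae ?_
  filter_upwards [hK, ae_integrable_update k hi] with x hx hix
  have hfx : Measurable fun y => f (Function.update x k y) := hf.comp (measurable_update x)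
  simp only [coordIntegral_update, coordMomentNorm_update]
  rw [lintegral_const_mul' _ _ ENNReal.ofReal_ne_top, lintegral_mul_const _ (by fun_prop),
    mul_left_comm]
  have h1 := lintegral_mul_exp_sub_exp_add_one_le (ν := μ k)
    (Y := fun y => f (Function.update x k y) - coordIntegral μ k f x)
    (hfx.sub_const _).aemeasurable β hM hx hβ
  have h2 := ofReal_exp_integral_le (hfx.const_mul β) (hix.const_mul β)
  rw [integral_const_mul] at h2
  exact mul_le_mul' h2 h1

theorem lintegral_exp_mul_ratio_le (hf : Measurable f) (k : ι) {r : (ι → Ω) → ℝ≥0∞}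
    (hr : Measurable r) (hr1 : ∀ x, ∫⁻ y, r (Function.update x k y) ∂μ k ≤ 1) :
    ∫⁻ x, ENNReal.ofReal (Real.exp (β * coordIntegral μ k f x)) * r x ∂Measure.pi μ ≤
      ∫⁻ x, ENNReal.ofReal (Real.exp (β * coordIntegral μ k f x)) ∂Measure.pi μ := by
  have hmi := measurable_coordIntegral (μ := μ) k hf
  rw [← lintegral_pi_update k (by fun_prop)]
  refine lintegral_mono fun x => ?_
  simp only [coordIntegral_update]
  rw [lintegral_const_mul' _ _ ENNReal.ofReal_ne_top]
  exact mul_le_of_le_one_right' (hr1 x)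

theorem lintegral_exp_coordIntegral_le (hf : Measurable f) (hi : Integrable f (Measure.pi μ))
    (k : ι) :
    ∫⁻ x, ENNReal.ofReal (Real.exp (β * coordIntegral μ k f x)) ∂Measure.pi μ ≤
      ∫⁻ x, ENNReal.ofReal (Real.exp (β * f x)) ∂Measure.pi μ := by
  conv_rhs => rw [← lintegral_pi_update k (by fun_prop)]
  refine lintegral_mono_ae ?_
  filter_upwards [ae_integrable_update k hi] with x hix
  have h2 := ofReal_exp_integral_le ((hf.comp (measurable_update x)).const_mul β)
    (hix.const_mul β)
  rwa [integral_const_mul] at h2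

/-- Write `log (e^{βf} / E e^{βf}) = ∑ log r_k` and apply the Gibbs inequality to `e^{β(f - m_k)}`
and `r_k`, scaled by `e^{βm_k}`. The sum of `e^{βm_k}` on the left pays for the `+ 1` that makes the
entropy term nonnegative. -/
theorem ae_exp_mul_log_add_le (hf : Measurable f)
    (he : Integrable (fun x => Real.exp (β * f x)) (Measure.pi μ)) :
    ∃ r : ι → (ι → Ω) → ℝ≥0∞, (∀ k, Measurable (r k)) ∧
      (∀ k x, ∫⁻ y, r k (Function.update x k y) ∂μ k ≤ 1) ∧
      ∀ᵐ x ∂Measure.pi μ,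
        Real.exp (β * f x) * (β * f x - cgf f (Measure.pi μ) β) +
          ∑ k, Real.exp (β * coordIntegral μ k f x) ≤
        ∑ k, (Real.exp (β * coordIntegral μ k f x) *
          (β * (f x - coordIntegral μ k f x) * Real.exp (β * (f x - coordIntegral μ k f x)) -
            Real.exp (β * (f x - coordIntegral μ k f x)) + 1) +
          Real.exp (β * coordIntegral μ k f x) * (r k x).toReal) := by
  have hgF : ∫⁻ x, ENNReal.ofReal (Real.exp (β * f x)) ∂Measure.pi μ =
      ENNReal.ofReal (mgf f (Measure.pi μ) β) :=
    (ofReal_integral_eq_lintegral_ofReal he (ae_of_all _ fun _ => (Real.exp_pos _).le)).symm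
  have hF : 0 < mgf f (Measure.pi μ) β := mgf_pos he
  obtain ⟨r, hrm, hr1, hr⟩ := exists_ae_eq_lmarginal_mul_prod (μ := μ)
    (g := fun x => ENNReal.ofReal (Real.exp (β * f x))) (by fun_prop)
    (fun x => by simp [Real.exp_pos]) (by rw [hgF]; exact ENNReal.ofReal_ne_top) Finset.univ
  refine ⟨r, hrm, hr1, ?_⟩
  filter_upwards [hr] with x hx
  rw [lmarginal_univ, hgF] at hx
  have hx' := congrArg ENNReal.toReal hx
  rw [ENNReal.toReal_ofReal (Real.exp_pos _).le, ENNReal.toReal_mul, ENNReal.toReal_ofReal hF.le,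
    ENNReal.toReal_prod] at hx'
  have hne : ∏ k, (r k x).toReal ≠ 0 := by
    intro h
    rw [h, mul_zero] at hx'
    exact (Real.exp_pos _).ne' hx'
  have hpos : ∀ k, 0 < (r k x).toReal := fun k =>
    lt_of_le_of_ne ENNReal.toReal_nonneg (Ne.symm (Finset.prod_ne_zero_iff.1 hne k (by simp)))
  have hlog : β * f x - cgf f (Measure.pi μ) β = ∑ k, Real.log (r k x).toReal := by
    have h := congrArg Real.log hx'
    rw [Real.log_exp, Real.log_mul hF.ne' hne, Real.log_prod (fun k _ => (hpos k).ne')] at h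
    rw [h, cgf]
    ring
  rw [hlog, Finset.mul_sum, ← Finset.sum_add_distrib]
  refine Finset.sum_le_sum fun k _ => ?_
  set m := coordIntegral μ k f x
  have hy := mul_log_le_mul_log_sub_add (Real.exp_pos (β * (f x - m))) (hpos k)
  rw [Real.log_exp] at hy
  have hsplit : Real.exp (β * f x) = Real.exp (β * m) * Real.exp (β * (f x - m)) := by
    rw [← Real.exp_add]; ring_nf
  have := mul_le_mul_of_nonneg_left hy (Real.exp_pos (β * m)).le
  rw [hsplit]
  linarith

theorem mul_exp_sub_exp_add_one_nonneg (u : ℝ) : 0 ≤ u * Real.exp u - Real.exp u + 1 := by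
  have h := mul_log_le_mul_log_sub_add (Real.exp_pos u) one_pos
  rw [Real.log_exp, Real.log_one] at h
  linarith

/-- Entropy bound for `exp (β f)` on a product space. -/
theorem integral_exp_mul_log_le (hf : Measurable f) (hi : Integrable f (Measure.pi μ))
    (hM : 0 ≤ M) (hV : 0 ≤ V)
    (hK : ∀ k, ∀ᵐ x ∂Measure.pi μ, coordMomentNorm μ f k x ≤ ENNReal.ofReal M)
    (hKV : ∀ᵐ x ∂Measure.pi μ, ∑ k, coordMomentNorm μ f k x ^ 2 ≤ ENNReal.ofReal V)
    (hβ : |β| * Real.exp 1 * M < 1)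
    (hfe : Integrable (fun x => f x * Real.exp (β * f x)) (Measure.pi μ)) :
    β * ∫ x, f x * Real.exp (β * f x) ∂Measure.pi μ -
        mgf f (Measure.pi μ) β * cgf f (Measure.pi μ) β ≤
      (β * Real.exp 1) ^ 2 / (1 - |β| * Real.exp 1 * M) ^ 2 * V * mgf f (Measure.pi μ) β := by
  set π := Measure.pi μ
  set c := (β * Real.exp 1) ^ 2 / (1 - |β| * Real.exp 1 * M) ^ 2 with hc
  have hc0 : 0 ≤ c := by positivity
  have he : Integrable (fun x => Real.exp (β * f x)) π :=
    integrable_exp_of_coordMomentNorm_le hf hi hK hβ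
  have hgF : ∫⁻ x, ENNReal.ofReal (Real.exp (β * f x)) ∂π = ENNReal.ofReal (mgf f π β) :=
    (ofReal_integral_eq_lintegral_ofReal he (ae_of_all _ fun _ => (Real.exp_pos _).le)).symm
  have hmi : ∀ k, Measurable (coordIntegral μ k f) := fun k => measurable_coordIntegral k hf
  have hmK : ∀ k, Measurable (coordMomentNorm μ f k) := measurable_coordMomentNorm hf
  have hA : ∀ k, Integrable (fun x => Real.exp (β * coordIntegral μ k f x)) π := by
    intro k
    have := hmi k
    refine ⟨by fun_prop, ?_⟩
    rw [hasFiniteIntegral_iff_ofReal (ae_of_all _ fun _ => (Real.exp_pos _).le)]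
    refine (lintegral_exp_coordIntegral_le hf hi k).trans_lt ?_
    rw [hgF]
    exact ENNReal.ofReal_lt_top
  have hW : Integrable (fun x => ∑ k, Real.exp (β * coordIntegral μ k f x)) π :=
    integrable_finsetSum _ fun k _ => hA k
  have hL : Integrable (fun x => Real.exp (β * f x) * (β * f x - cgf f π β)) π := by
    have := (hfe.const_mul β).sub (he.mul_const (cgf f π β))
    refine this.congr (ae_of_all _ fun x => ?_)
    simp only [Pi.sub_apply]
    ring
  obtain ⟨r, hrm, hr1, hr⟩ := ae_exp_mul_log_add_le hf he
  -- All terms on the right are nonnegative, so lower integrals need no integrability check. The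
  -- integral of `∑ e^{βm_k}` reappears on the right because the `r_k` have partial integrals at
  -- most `1`; it cancels at the end.
  have hbound : ∫⁻ x, ENNReal.ofReal (Real.exp (β * f x) * (β * f x - cgf f π β) +
      ∑ k, Real.exp (β * coordIntegral μ k f x)) ∂π ≤
      ENNReal.ofReal (c * V * mgf f π β + ∫ x, ∑ k, Real.exp (β * coordIntegral μ k f x) ∂π) := by
    calc _ ≤ ∫⁻ x, ∑ k, (ENNReal.ofReal (Real.exp (β * coordIntegral μ k f x)) *
          ENNReal.ofReal (β * (f x - coordIntegral μ k f x) *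
            Real.exp (β * (f x - coordIntegral μ k f x)) -
            Real.exp (β * (f x - coordIntegral μ k f x)) + 1) +
          ENNReal.ofReal (Real.exp (β * coordIntegral μ k f x)) * r k x) ∂π := by
          refine lintegral_mono_ae ?_
          filter_upwards [hr] with x hx
          refine (ENNReal.ofReal_le_ofReal hx).trans ?_
          rw [ENNReal.ofReal_sum_of_nonneg fun k _ => add_nonneg
            (mul_nonneg (Real.exp_pos _).le (mul_exp_sub_exp_add_one_nonneg _))
            (mul_nonneg (Real.exp_pos _).le ENNReal.toReal_nonneg)]
          gcongr with k
          refine ENNReal.ofReal_add_le.trans ?_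
          rw [ENNReal.ofReal_mul (Real.exp_pos _).le, ENNReal.ofReal_mul (Real.exp_pos _).le]
          gcongr
          exact ENNReal.ofReal_toReal_le
      _ = ∑ k, (∫⁻ x, ENNReal.ofReal (Real.exp (β * coordIntegral μ k f x)) *
          ENNReal.ofReal (β * (f x - coordIntegral μ k f x) *
            Real.exp (β * (f x - coordIntegral μ k f x)) -
            Real.exp (β * (f x - coordIntegral μ k f x)) + 1) ∂π +
          ∫⁻ x, ENNReal.ofReal (Real.exp (β * coordIntegral μ k f x)) * r k x ∂π) := by
          rw [lintegral_finsetSum _ fun k _ => by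
            have := hmi k; have := hrm k; fun_prop]
          refine Finset.sum_congr rfl fun k _ => lintegral_add_left ?_ _
          have := hmi k
          fun_prop
      _ ≤ ∑ k, (ENNReal.ofReal c * ∫⁻ x, ENNReal.ofReal (Real.exp (β * f x)) *
            coordMomentNorm μ f k x ^ 2 ∂π +
          ∫⁻ x, ENNReal.ofReal (Real.exp (β * coordIntegral μ k f x)) ∂π) := by
          exact Finset.sum_le_sum fun k _ => add_le_add
            (lintegral_exp_mul_entropyTerm_le hf hi hM k (hK k) hβ)
            (lintegral_exp_mul_ratio_le hf k (hrm k) (hr1 k))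
      _ = ENNReal.ofReal c * ∫⁻ x, ENNReal.ofReal (Real.exp (β * f x)) *
            ∑ k, coordMomentNorm μ f k x ^ 2 ∂π +
          ENNReal.ofReal (∫ x, ∑ k, Real.exp (β * coordIntegral μ k f x) ∂π) := by
          rw [Finset.sum_add_distrib, ← Finset.mul_sum, ← lintegral_finsetSum _ fun k _ => by
            have := hmK k; fun_prop]
          simp_rw [Finset.mul_sum]
          congr 1
          rw [integral_finsetSum _ fun k _ => hA k, ENNReal.ofReal_sum_of_nonneg fun k _ =>
            integral_nonneg fun x => (Real.exp_pos _).le]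
          refine Finset.sum_congr rfl fun k _ => ?_
          rw [ofReal_integral_eq_lintegral_ofReal (hA k) (ae_of_all _ fun _ => (Real.exp_pos _).le)]
      _ ≤ ENNReal.ofReal c * ∫⁻ x, ENNReal.ofReal (Real.exp (β * f x)) * ENNReal.ofReal V ∂π +
          ENNReal.ofReal (∫ x, ∑ k, Real.exp (β * coordIntegral μ k f x) ∂π) := by
          gcongr 2
          refine lintegral_mono_ae ?_
          filter_upwards [hKV] with x hx
          gcongr
      _ = _ := by
          rw [lintegral_mul_const' _ _ ENNReal.ofReal_ne_top, hgF, ← ENNReal.ofReal_mul mgf_nonneg,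
            ← ENNReal.ofReal_mul hc0, ← ENNReal.ofReal_add
              (mul_nonneg hc0 (mul_nonneg mgf_nonneg hV))
              (integral_nonneg fun x => Finset.sum_nonneg fun k _ => (Real.exp_pos _).le)]
          congr 1
          ring
  have hle : ∫ x, (Real.exp (β * f x) * (β * f x - cgf f π β) +
      ∑ k, Real.exp (β * coordIntegral μ k f x)) ∂π ≤
      c * V * mgf f π β + ∫ x, ∑ k, Real.exp (β * coordIntegral μ k f x) ∂π := by
    refine (integral_eq_lintegral_pos_part_sub_lintegral_neg_part (hL.add hW)).trans_le ?_
    refine (sub_le_self _ ENNReal.toReal_nonneg).trans (ENNReal.toReal_le_of_le_ofReal ?_ hbound)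
    exact add_nonneg (mul_nonneg (mul_nonneg hc0 hV) mgf_nonneg)
      (integral_nonneg fun x => Finset.sum_nonneg fun k _ => (Real.exp_pos _).le)
  rw [integral_add hL hW] at hle
  have hLeq : ∫ x, Real.exp (β * f x) * (β * f x - cgf f π β) ∂π =
      β * ∫ x, f x * Real.exp (β * f x) ∂π - mgf f π β * cgf f π β := by
    rw [← integral_const_mul, mgf, ← integral_mul_const,
      ← integral_sub (hfe.const_mul β) (he.mul_const _)]
    congr 1 with x
    ring
  linarith

end Tensorization

/-! ### From the entropy bound to the tail bound. -/

section Herbst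

variable {S : Type*} [MeasurableSpace S] {μ : Measure S} [IsProbabilityMeasure μ] {Y : S → ℝ}
  {a v : ℝ}

theorem mem_interior_integrableExpSet_of_forall_abs_mul_lt
    (he : ∀ β : ℝ, |β| * a < 1 → Integrable (fun s => Real.exp (β * Y s)) μ) {β : ℝ}
    (hβ : |β| * a < 1) : β ∈ interior (integrableExpSet Y μ) := by
  refine mem_interior.2 ⟨{β | |β| * a < 1}, fun b hb => he b hb, ?_, hβ⟩
  exact isOpen_lt (by fun_prop) continuous_const

/-- Herbst's argument for a sub-gamma entropy bound. -/
theorem cgf_le_of_entropy_le (ha : 0 ≤ a)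
    (he : ∀ β : ℝ, |β| * a < 1 → Integrable (fun s => Real.exp (β * Y s)) μ)
    (hent : ∀ β : ℝ, 0 < β → β * a < 1 →
      β * ∫ s, Y s * Real.exp (β * Y s) ∂μ - mgf Y μ β * cgf Y μ β ≤
        β ^ 2 * v / (1 - β * a) ^ 2 * mgf Y μ β)
    {l : ℝ} (hl : 0 < l) (hla : l * a < 1) :
    cgf Y μ l ≤ l * ∫ s, Y s ∂μ + v * l ^ 2 / (1 - l * a) := by
  have hlt : ∀ β ∈ Set.Ioc 0 l, β * a < 1 := fun β hβ =>
    (mul_le_mul_of_nonneg_right hβ.2 ha).trans_lt hla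
  have hmem : ∀ β ∈ Set.Ioc 0 l, β ∈ interior (integrableExpSet Y μ) := fun β hβ =>
    mem_interior_integrableExpSet_of_forall_abs_mul_lt he (by
      rw [abs_of_pos hβ.1]; exact hlt β hβ)
  -- The entropy bound says `(cgf / β)' ≤ v / (1 - βa)²`, the derivative of `vβ / (1 - βa)`. So `D`
  -- is antitone, and its limit at `0+` is `cgf'(0)`, the mean.
  set D : ℝ → ℝ := fun β => cgf Y μ β / β - v * β / (1 - β * a) with hD
  have hder : ∀ β ∈ Set.Ioc 0 l, HasDerivAt D
      ((deriv (cgf Y μ) β * β - cgf Y μ β * 1) / β ^ 2 -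
        (v * 1 * (1 - β * a) - v * β * (-(1 * a))) / (1 - β * a) ^ 2) β := by
    intro β hβ
    have h1 := (analyticAt_cgf (hmem β hβ)).differentiableAt.hasDerivAt
    have h2 : HasDerivAt (fun β : ℝ => 1 - β * a) (-(1 * a)) β :=
      ((hasDerivAt_id β).mul_const a).const_sub 1
    exact (h1.div (hasDerivAt_id β) hβ.1.ne').sub
      (((hasDerivAt_id β).const_mul v).div h2 (by linarith [hlt β hβ]))
  have hanti : AntitoneOn D (Set.Ioc 0 l) := by
    refine antitoneOn_of_deriv_nonpos (convex_Ioc 0 l)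
      (fun β hβ => (hder β hβ).continuousAt.continuousWithinAt)
      (fun β hβ => (hder β (interior_subset hβ)).differentiableAt.differentiableWithinAt)
      fun β hβ => ?_
    have hβ' := interior_subset hβ
    rw [(hder β hβ').deriv, deriv_cgf (hmem β hβ')]
    have hF : 0 < mgf Y μ β := mgf_pos (he β (by rw [abs_of_pos hβ'.1]; exact hlt β hβ'))
    have h3 := hent β hβ'.1 (hlt β hβ')
    have hpos : 0 < 1 - β * a := by linarith [hlt β hβ']
    have hβ0 := hβ'.1
    have h4 : (∫ s, Y s * Real.exp (β * Y s) ∂μ) / mgf Y μ β * β - cgf Y μ β * 1 ≤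
        β ^ 2 * v / (1 - β * a) ^ 2 := by
      have : (∫ s, Y s * Real.exp (β * Y s) ∂μ) / mgf Y μ β * β - cgf Y μ β * 1 =
          (β * ∫ s, Y s * Real.exp (β * Y s) ∂μ - mgf Y μ β * cgf Y μ β) / mgf Y μ β := by
        field_simp
        ring
      rw [this, div_le_iff₀ hF]
      exact h3
    have h5 : (v * 1 * (1 - β * a) - v * β * (-(1 * a))) / (1 - β * a) ^ 2 =
        (β ^ 2 * v / (1 - β * a) ^ 2) / β ^ 2 := by
      field_simp
      ring
    rw [h5, sub_nonpos]
    gcongr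
  have h0 : (0 : ℝ) ∈ interior (integrableExpSet Y μ) :=
    mem_interior_integrableExpSet_of_forall_abs_mul_lt he (by simp)
  have hlim : Tendsto D (𝓝[>] 0) (𝓝 (∫ s, Y s ∂μ)) := by
    have h1 : HasDerivAt (cgf Y μ) (∫ s, Y s ∂μ) 0 := by
      have := (analyticAt_cgf h0).differentiableAt.hasDerivAt
      rw [deriv_cgf_zero h0] at this
      simpa using this
    have h2 := (hasDerivAt_iff_tendsto_slope.1 h1).mono_left
      (nhdsWithin_mono (0 : ℝ) fun (b : ℝ) (hb : 0 < b) => hb.ne')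
    have h3 : Tendsto (fun β : ℝ => v * β / (1 - β * a)) (𝓝[>] 0) (𝓝 0) := by
      have hc : ContinuousAt (fun β : ℝ => v * β / (1 - β * a)) 0 :=
        ContinuousAt.div (by fun_prop) (by fun_prop) (by simp)
      simpa using hc.tendsto.mono_left nhdsWithin_le_nhds
    have h4 := h2.sub h3
    rw [sub_zero] at h4
    refine h4.congr fun β => ?_
    simp [hD, slope_def_field, cgf_zero]
  have hle : D l ≤ ∫ s, Y s ∂μ := by
    refine ge_of_tendsto hlim ?_
    filter_upwards [Ioc_mem_nhdsGT hl] with β hβ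
    exact hanti hβ ⟨hl, le_rfl⟩ hβ.2
  have hpos : 0 < 1 - l * a := by linarith
  have h6 : cgf Y μ l = l * D l + v * l ^ 2 / (1 - l * a) := by
    simp only [hD]
    field_simp
    ring
  rw [h6]
  gcongr

theorem measureReal_gt_le_of_cgf_le (ha : 0 ≤ a) (hv : 0 < v)
    (he : ∀ β : ℝ, |β| * a < 1 → Integrable (fun s => Real.exp (β * Y s)) μ)
    (hcgf : ∀ l : ℝ, 0 < l → l * a < 1 →
      cgf Y μ l ≤ l * ∫ s, Y s ∂μ + v * l ^ 2 / (1 - l * a)) {t : ℝ} (ht : 0 < t) :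
    μ.real {s | Y s - ∫ s', Y s' ∂μ > t} ≤ Real.exp (-(t ^ 2 / (4 * v + 2 * a * t))) := by
  set m := ∫ s, Y s ∂μ
  have hden : 0 < 2 * v + a * t := by positivity
  -- With this choice `1 - la = 2v / (2v + at)`, so the quadratic term is exactly half of `lt`.
  set l := t / (2 * v + a * t) with hl
  have hl0 : 0 < l := by positivity
  have h1 : 1 - l * a = 2 * v / (2 * v + a * t) := by rw [hl]; field_simp; ring
  have hla : l * a < 1 := by
    have : 0 < 2 * v / (2 * v + a * t) := by positivity
    linarith
  calc μ.real {s | Y s - m > t} ≤ μ.real {s | m + t ≤ Y s} :=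
        measureReal_mono fun s (hs : Y s - m > t) => by
          simp only [Set.mem_ofPred_eq]; linarith
    _ ≤ Real.exp (-l * (m + t) + cgf Y μ l) :=
        measure_ge_le_exp_cgf _ hl0.le (he l (by rwa [abs_of_pos hl0]))
    _ ≤ _ := by
        refine Real.exp_le_exp.2 ?_
        have h2 := hcgf l hl0 hla
        have h3 : -l * t + v * l ^ 2 / (1 - l * a) = -(t ^ 2 / (4 * v + 2 * a * t)) := by
          rw [h1, hl]
          have : 4 * v + 2 * a * t = 2 * (2 * v + a * t) := by ring
          rw [this]
          field_simp
          ring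
        linarith

theorem measure_gt_le_exp_of_cgf_le (ha : 0 ≤ a) (hv : 0 ≤ v)
    (he : ∀ β : ℝ, |β| * a < 1 → Integrable (fun s => Real.exp (β * Y s)) μ)
    (hcgf : ∀ l : ℝ, 0 < l → l * a < 1 →
      cgf Y μ l ≤ l * ∫ s, Y s ∂μ + v * l ^ 2 / (1 - l * a)) {t : ℝ} (ht : 0 < t) :
    μ {s | Y s - ∫ s', Y s' ∂μ > t} ≤ EReal.exp (-((ENNReal.ofReal (t ^ 2) /
      ENNReal.ofReal (4 * v + 2 * a * t) : ℝ≥0∞) : EReal)) := by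
  -- For `v = 0` the Chernoff parameter would violate `la < 1`. Hence `v` is enlarged to `w`, and `w
  -- ↓ v` afterwards; a zero limiting denominator gives probability `0`.
  have key : ∀ w, v < w →
      μ.real {s | Y s - ∫ s', Y s' ∂μ > t} ≤ Real.exp (-(t ^ 2 / (4 * w + 2 * a * t))) := by
    intro w hw
    refine measureReal_gt_le_of_cgf_le ha (hv.trans_lt hw) he (fun l hl hla => ?_) ht
    refine (hcgf l hl hla).trans ?_
    have : 0 < 1 - l * a := by linarith
    gcongr
  have hev : ∀ᶠ w in 𝓝[>] v,
      μ.real {s | Y s - ∫ s', Y s' ∂μ > t} ≤ Real.exp (-(t ^ 2 / (4 * w + 2 * a * t))) := by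
    filter_upwards [self_mem_nhdsWithin] with w hw using key w hw
  have hden : Tendsto (fun w : ℝ => 4 * w + 2 * a * t) (𝓝[>] v) (𝓝 (4 * v + 2 * a * t)) :=
    ((by fun_prop : Continuous fun w : ℝ => 4 * w + 2 * a * t).tendsto v).mono_left
      nhdsWithin_le_nhds
  have hnn : 0 ≤ 4 * v + 2 * a * t := by positivity
  rw [← ofReal_measureReal]
  rcases hnn.eq_or_lt with h0 | hpos
  · have hden' : Tendsto (fun w : ℝ => 4 * w + 2 * a * t) (𝓝[>] v) (𝓝[>] 0) := by
      refine tendsto_nhdsWithin_iff.2 ⟨by rwa [← h0] at hden, ?_⟩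
      filter_upwards [self_mem_nhdsWithin] with w (hw : v < w)
      simp only [Set.mem_Ioi]
      linarith
    have hlim : Tendsto (fun w : ℝ => Real.exp (-(t ^ 2 / (4 * w + 2 * a * t)))) (𝓝[>] v) (𝓝 0) :=
      Real.tendsto_exp_neg_atTop_nhds_zero.comp
        ((tendsto_inv_nhdsGT_zero.comp hden').const_mul_atTop (by positivity : 0 < t ^ 2))
    rw [ENNReal.ofReal_of_nonpos (ge_of_tendsto hlim hev)]
    exact zero_le
  · have hlim : Tendsto (fun w : ℝ => Real.exp (-(t ^ 2 / (4 * w + 2 * a * t)))) (𝓝[>] v)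
        (𝓝 (Real.exp (-(t ^ 2 / (4 * v + 2 * a * t))))) :=
      (Real.continuous_exp.tendsto _).comp (tendsto_const_nhds.div hden hpos.ne').neg
    rw [← ENNReal.ofReal_div_of_pos hpos, EReal.coe_ennreal_ofReal,
      max_eq_left (by positivity), ← EReal.coe_neg, EReal.exp_coe]
    exact ENNReal.ofReal_le_ofReal (ge_of_tendsto hlim hev)

end Herbst

/-! ### Comparison of the Orlicz norm with linear moment growth. -/

section Orlicz

variable {φ : ℝ → ℝ}

theorem IsOrliczNFunction.exists_nonneg_eq (hφ : IsOrliczNFunction φ) {q : ℝ} (hq : 0 ≤ q) :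
    ∃ z ∈ Set.Ici (0 : ℝ), φ z = q := by
  obtain ⟨x, hx1, hx⟩ := ((eventually_ge_atTop (1 : ℝ)).and
    (hφ.tendsto_atTop.eventually_ge_atTop q)).exists
  have hx0 : 0 < x := by linarith
  rw [le_div_iff₀ hx0] at hx
  have hqx : q ≤ φ x := (le_mul_of_one_le_right hq hx1).trans hx
  obtain ⟨z, hz, hzq⟩ := intermediate_value_Icc hx0.le hφ.continuous.continuousOn
    ⟨hφ.map_zero.trans_le hq, hqx⟩
  exact ⟨z, hz.1, hzq⟩

theorem IsOrliczNFunction.map_orliczInv (hφ : IsOrliczNFunction φ) {q : ℝ} (hq : 0 ≤ q) :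
    φ (orliczInv φ q) = q :=
  Function.invFunOn_eq (hφ.exists_nonneg_eq hq)

theorem IsOrliczNFunction.orliczInv_le_self (hφ : IsOrliczNFunction φ) (h1 : orliczInv φ 1 = 1)
    {q : ℝ} (hq : 1 ≤ q) : orliczInv φ q ≤ q := by
  have hφ1 : φ 1 = 1 := by simpa [h1] using hφ.map_orliczInv zero_le_one
  have hz := hφ.map_orliczInv (zero_le_one.trans hq)
  set z := orliczInv φ q
  rcases le_total z 1 with hz1 | hz1
  · exact hz1.trans hq
  have hz0 : 0 < z := by linarith
  -- Convexity at `1 = z⁻¹ · z + (1 - z⁻¹) · 0` gives `1 = φ 1 ≤ φ z / z = q / z`.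
  have h := hφ.convexOn.2 (Set.mem_univ z) (Set.mem_univ 0) (inv_nonneg.2 hz0.le)
    (sub_nonneg.2 (inv_le_one_of_one_le₀ hz1)) (by ring)
  simp only [smul_eq_mul, mul_zero, add_zero, inv_mul_cancel₀ hz0.ne', hφ1, hφ.map_zero, hz] at h
  rwa [inv_mul_eq_div, le_div_iff₀ hz0, one_mul] at h

theorem linearMomentNorm_le_orliczMomentNorm {S : Type*} [MeasurableSpace S]
    (hφ : IsOrliczNFunction φ) (h1 : orliczInv φ 1 = 1) (Y : S → ℝ) (P : Measure S) :
    linearMomentNorm Y P ≤ orliczMomentNorm φ Y P := by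
  refine iSup_le fun p => ?_
  have hp : (1 : ℝ) ≤ ((p + 1 : ℕ) : ℝ) := by simp
  refine le_trans ?_ (le_iSup₂ (f := fun (q : ℝ) (_ : 1 ≤ q) =>
    eLpNorm Y (ENNReal.ofReal q) P / ENNReal.ofReal (orliczInv φ q)) ((p + 1 : ℕ) : ℝ) hp)
  rw [ENNReal.ofReal_natCast]
  refine ENNReal.div_le_div_left ?_ _
  exact (ENNReal.ofReal_le_ofReal (hφ.orliczInv_le_self h1 hp)).trans_eq (ENNReal.ofReal_natCast _)

end Orlicz

/-! ### Transfer to the law of `X` and conclusion. -/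

theorem coordIntegral_map {S Ω : Type*} [MeasurableSpace S] [MeasurableSpace Ω] {P : Measure S}
    {n : ℕ} {X : Fin n → S → Ω} (hX : ∀ i, Measurable (X i)) {f : (Fin n → Ω) → ℝ}
    (hf : Measurable f) (k : Fin n) (x : Fin n → Ω) :
    coordIntegral (fun i => P.map (X i)) k f x = ∫ s, f (Function.update x k (X k s)) ∂P :=
  integral_map (hX k).aemeasurable (hf.comp (measurable_update x)).aestronglyMeasurable

theorem coordMomentNorm_map {S Ω : Type*} [MeasurableSpace S] [MeasurableSpace Ω] {P : Measure S}
    {n : ℕ} {X : Fin n → S → Ω} (hX : ∀ i, Measurable (X i)) {f : (Fin n → Ω) → ℝ}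
    (hf : Measurable f) (k : Fin n) (x : Fin n → Ω) :
    coordMomentNorm (fun i => P.map (X i)) f k x =
      linearMomentNorm (centeredCondVersion P X f k x) P := by
  unfold coordMomentNorm linearMomentNorm
  congr 1 with p
  have hm : Measurable fun y =>
      f (Function.update x k y) - coordIntegral (fun i => P.map (X i)) k f x :=
    (hf.comp (measurable_update x)).sub_const _
  rw [eLpNorm_map_measure hm.aestronglyMeasurable (hX k).aemeasurable, coordIntegral_map hX hf]
  rfl

theorem mainTheorem4 {S Ω : Type*} [MeasurableSpace S] [MeasurableSpace Ω]
    (P : Measure S) [IsProbabilityMeasure P]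
    (φ : ℝ → ℝ) (hφ : IsOrliczNFunction φ) (hφ1 : orliczInv φ 1 = 1)
    (n : ℕ) (X : Fin n → S → Ω) (hX : ∀ i, Measurable (X i)) (hindep : iIndepFun X P)
    (f : (Fin n → Ω) → ℝ) (hf : Measurable f)
    (hint : Integrable (fun s => f (fun i => X i s)) P)
    (t : ℝ) (ht : 0 < t) :
    P {s | f (fun i => X i s) - ∫ s', f (fun i => X i s') ∂P > t} ≤
      EReal.exp (-((ENNReal.ofReal (t ^ 2) /
        (ENNReal.ofReal (4 * Real.exp 1 ^ 2) * condVarianceProxy φ P X f +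
          ENNReal.ofReal (2 * Real.exp 1) * condScaleProxy φ P X f * ENNReal.ofReal t) :
            ℝ≥0∞) : EReal)) := by
  -- An infinite denominator makes the right side `exp 0 = 1`.
  by_cases hVtop : condVarianceProxy φ P X f = ∞
  · rw [hVtop, ENNReal.mul_top (by simp [Real.exp_pos]), top_add, ENNReal.div_top]
    simpa using prob_le_one
  by_cases hMtop : condScaleProxy φ P X f = ∞
  · rw [hMtop, ENNReal.mul_top (by simp [Real.exp_pos]), ENNReal.top_mul (by simp [ht]), add_top,
      ENNReal.div_top]
    simpa using prob_le_one
  set μ : Fin n → Measure Ω := fun i => P.map (X i) with hμ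
  have hprob : ∀ i, IsProbabilityMeasure (μ i) := fun i =>
    Measure.isProbabilityMeasure_map (hX i).aemeasurable
  have hXm : Measurable fun s i => X i s := measurable_pi_lambda _ hX
  have hlaw : P.map (fun s i => X i s) = Measure.pi μ :=
    (iIndepFun_iff_map_fun_eq_pi_map fun i => (hX i).aemeasurable).1 hindep
  have hi : Integrable f (Measure.pi μ) := by
    rw [← hlaw, integrable_map_measure hf.aestronglyMeasurable hXm.aemeasurable]
    exact hint
  have hnorm : ∀ k x, coordMomentNorm μ f k x ≤
      orliczMomentNorm φ (centeredCondVersion P X f k x) P := fun k x =>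
    (coordMomentNorm_map hX hf k x).trans_le (linearMomentNorm_le_orliczMomentNorm hφ hφ1 _ _)
  have hmK : ∀ k, Measurable (coordMomentNorm μ f k) := measurable_coordMomentNorm hf
  set M := (condScaleProxy φ P X f).toReal with hMdef
  set V := (condVarianceProxy φ P X f).toReal with hVdef
  have hMeq : condScaleProxy φ P X f = ENNReal.ofReal M := (ENNReal.ofReal_toReal hMtop).symm
  have hVeq : condVarianceProxy φ P X f = ENNReal.ofReal V := (ENNReal.ofReal_toReal hVtop).symm
  have hM : 0 ≤ M := ENNReal.toReal_nonneg
  have hV : 0 ≤ V := ENNReal.toReal_nonneg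
  -- Transfer through `ae_map_iff` uses the measurable `coordMomentNorm`; the Orlicz norm, an
  -- uncountable supremum, is compared only under `P`, where the essential supremum bound needs no
  -- measurability.
  have hK : ∀ k, ∀ᵐ x ∂Measure.pi μ, coordMomentNorm μ f k x ≤ ENNReal.ofReal M := by
    intro k
    rw [← hlaw, ae_map_iff hXm.aemeasurable (measurableSet_le (hmK k) measurable_const), ← hMeq]
    filter_upwards [ENNReal.ae_le_essSup (μ := P) fun s =>
      orliczMomentNorm φ (centeredCondVersion P X f k (fun i => X i s)) P] with s hs
    exact (hnorm k _).trans (hs.trans (le_iSup (fun k => essSup (fun s =>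
      orliczMomentNorm φ (centeredCondVersion P X f k (fun i => X i s)) P) P) k))
  have hKV : ∀ᵐ x ∂Measure.pi μ, ∑ k, coordMomentNorm μ f k x ^ 2 ≤ ENNReal.ofReal V := by
    rw [← hlaw, ae_map_iff hXm.aemeasurable (measurableSet_le
      (Finset.measurable_sum _ fun k _ => (hmK k).pow_const 2) measurable_const), ← hVeq]
    filter_upwards [ENNReal.ae_le_essSup (μ := P) fun s =>
      ∑ k, orliczMomentNorm φ (centeredCondVersion P X f k (fun i => X i s)) P ^ 2] with s hs
    exact (Finset.sum_le_sum fun k _ => pow_le_pow_left' (hnorm k _) 2).trans hs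
  have ha : 0 ≤ Real.exp 1 * M := by positivity
  have hv : 0 ≤ Real.exp 1 ^ 2 * V := by positivity
  have he : ∀ β : ℝ, |β| * (Real.exp 1 * M) < 1 →
      Integrable (fun x => Real.exp (β * f x)) (Measure.pi μ) := fun β hβ =>
    integrable_exp_of_coordMomentNorm_le hf hi hK (by rwa [mul_assoc])
  have hent : ∀ β : ℝ, 0 < β → β * (Real.exp 1 * M) < 1 →
      β * ∫ x, f x * Real.exp (β * f x) ∂Measure.pi μ -
        mgf f (Measure.pi μ) β * cgf f (Measure.pi μ) β ≤
        β ^ 2 * (Real.exp 1 ^ 2 * V) / (1 - β * (Real.exp 1 * M)) ^ 2 * mgf f (Measure.pi μ) β := by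
    intro β hβ hβM
    have hβ' : |β| * (Real.exp 1 * M) < 1 := by rwa [abs_of_pos hβ]
    have hfe : Integrable (fun x => f x * Real.exp (β * f x)) (Measure.pi μ) := by
      simpa using integrable_pow_mul_exp_of_mem_interior_integrableExpSet
        (mem_interior_integrableExpSet_of_forall_abs_mul_lt he hβ') 1
    refine (integral_exp_mul_log_le hf hi hM hV hK hKV (by rwa [mul_assoc]) hfe).trans_eq ?_
    rw [abs_of_pos hβ]
    ring
  have hmain := measure_gt_le_exp_of_cgf_le ha hv he
    (fun l hl hla => cgf_le_of_entropy_le ha he hent hl hla) ht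
  have hmean : ∫ x, f x ∂Measure.pi μ = ∫ s, f (fun i => X i s) ∂P := by
    rw [← hlaw, integral_map hXm.aemeasurable hf.aestronglyMeasurable]
  have hset : Measure.pi μ {x | f x - ∫ x', f x' ∂Measure.pi μ > t} =
      P {s | f (fun i => X i s) - ∫ s', f (fun i => X i s') ∂P > t} := by
    rw [hmean, ← hlaw, Measure.map_apply hXm (measurableSet_lt measurable_const (by fun_prop))]
    rfl
  have hden : ENNReal.ofReal (4 * Real.exp 1 ^ 2) * condVarianceProxy φ P X f +
      ENNReal.ofReal (2 * Real.exp 1) * condScaleProxy φ P X f * ENNReal.ofReal t =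
      ENNReal.ofReal (4 * (Real.exp 1 ^ 2 * V) + 2 * (Real.exp 1 * M) * t) := by
    rw [hVeq, hMeq, ← ENNReal.ofReal_mul (by positivity), ← ENNReal.ofReal_mul (by positivity),
      ← ENNReal.ofReal_mul (by positivity), ← ENNReal.ofReal_add (by positivity) (by positivity)]
    congr 1
    ring
  rw [hden, ← hset]
  exact hmain
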